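/- Call a subset of a topological space \emph{perfect} if it is nonempty, closed and has no isolated points, and call it \emph{universally measurable} if it is measurable with respect to the completion of every $\sigma$-finite Borel measure on the space. For a Polish space $P$, a \emph{cube} in $P$ is a continuous injection $f\colon \prod_{n\in\omega} C_n\to P$, where each $C_n$ is a perfect subset of the Cantor space $2^{\omega}$. A family $\mathcal E$ of perfect subsets of $P$ is \emph{$\mathcal F_{cube}$-dense} if for every cube $f$ in $P$ there is a cube $g$ in $P$ with $g\subseteq f$ (that is, $g$ is a restriction of $f$) and $\operatorname{range}(g)\in\mathcal E$. The axiom $\mathrm{CPA}_{cube}(P)$ says that for every $\mathcal F_{cube}$-dense family $\mathcal E$ of perfect subsets of $P$ there is $\mathcal E_0\subseteq\mathcal E$ with $|\mathcal E_0|\le\aleph_1$ and $|P\setminus\bigcup\mathcal E_0|\le\aleph_1$. \textbf{Theorem.} Let $P$ be a Polish space such that $\mathrm{CPA}_{cube}(P)$ holds. Then every universally measurable subset of $P$ is the union of a family of at most $\aleph_1$ sets, each of which is either a perfect set or a singleton. -/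

import Mathlib

open MeasureTheory

universe u

namespace CPACube

/-- The Cantor space `2^ω`, with its product topology. -/
abbrev Cantor : Type := ℕ → Bool

/-- Perfect sets: nonempty, closed and without isolated points. -/
def IsPerfectSet {X : Type u} [TopologicalSpace X] (C : Set X) : Prop :=
  Perfect C ∧ C.Nonempty

/-- A cube in `P`: a continuous injection into `P` from a product `∏ₙ Cₙ` of perfect subsets
`Cₙ` of the Cantor space. -/
structure Cube (P : Type u) [TopologicalSpace P] where
  side : ℕ → Set Cantor
  isPerfectSet_side : ∀ n, IsPerfectSet (side n)
  toFun : (∀ n, side n) → P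
  continuous_toFun : Continuous toFun
  injective_toFun : Function.Injective toFun

/-- The graph of a cube, as a partial function from `(2^ω)^ω` to `P`. -/
def Cube.graph {P : Type u} [TopologicalSpace P] (f : Cube P) : Set ((ℕ → Cantor) × P) :=
  {p | ∃ x : ∀ n, f.side n, (∀ n, p.1 n = x n) ∧ p.2 = f.toFun x}

/-- The range of a cube. -/
def Cube.range {P : Type u} [TopologicalSpace P] (f : Cube P) : Set P :=
  Set.range f.toFun

/-- A family `E` of sets is dense for cubes if every cube `f` has a subcube `g ⊆ f`
(as functions, that is, as graphs) whose range belongs to `E`. -/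
def IsCubeDense {P : Type u} [TopologicalSpace P] (E : Set (Set P)) : Prop :=
  ∀ f : Cube P, ∃ g : Cube P, g.graph ⊆ f.graph ∧ g.range ∈ E

/-- The axiom `CPA_cube(P)`. -/
def CPACubeAxiom (P : Type u) [TopologicalSpace P] : Prop :=
  ∀ E : Set (Set P), (∀ C ∈ E, IsPerfectSet C) → IsCubeDense E →
    ∃ E₀ : Set (Set P), E₀ ⊆ E ∧ Cardinal.mk E₀ ≤ Cardinal.aleph 1 ∧
      Cardinal.mk ((⋃₀ E₀)ᶜ : Set P) ≤ Cardinal.aleph 1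

/-- A set is universally measurable if it is measurable with respect to the completion of
every `σ`-finite measure on the Borel `σ`-algebra. -/
def IsUniversallyMeasurable {P : Type u} [TopologicalSpace P] (A : Set P) : Prop :=
  ∀ μ : @Measure P (borel P), @SigmaFinite P (borel P) μ → @NullMeasurableSet P (borel P) A μ

end CPACube

open Filter Topology Set
open scoped Pointwise

namespace CPACube

/-! Apply the axiom to the perfect sets contained in `A` or disjoint from it. The chosen sets inside
`A`, with singletons for the uncovered points of `A`, exhaust `A`. Density is a measure argument.
Inside a cube, copy the compact group 2^(ω × ω) and push its Haar measure forward: `A` or its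
complement pulls back to a set of positive measure, which contains a closed `K` of positive measure.
Translation by a late bit moves `K` little, so bits can be freed one at a time, infinitely many in
each row, leaving a product of perfect sets in `K`. -/

/-- The set of all functions that agree with `x` off `B`. -/
def agreeOff {J X : Type*} (B : Set J) (x : J → X) : Set (J → X) :=
  {y | ∀ j ∉ B, y j = x j}

theorem isClosed_agreeOff {J X : Type*} [TopologicalSpace X] [T1Space X] (B : Set J) (x : J → X) :
    IsClosed (agreeOff B x) := by
  have : agreeOff B x = ⋂ j ∈ Bᶜ, (fun y : J → X => y j) ⁻¹' {x j} := by
    ext y; simp [agreeOff]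
  rw [this]
  exact isClosed_biInter fun j _ => isClosed_singleton.preimage (continuous_apply j)

theorem isPerfectSet_agreeOff {J X : Type*} [TopologicalSpace X] [T1Space X] [Nontrivial X]
    {B : Set J} (hB : B.Infinite) (x : J → X) : IsPerfectSet (agreeOff B x) := by
  classical
  refine ⟨⟨isClosed_agreeOff B x, preperfect_iff_nhds.2 fun y hy U hU => ?_⟩,
    x, fun _ _ => rfl⟩
  rw [nhds_pi, Filter.mem_pi] at hU
  obtain ⟨I, hI, t, ht, htU⟩ := hU
  obtain ⟨b, hbB, hbI⟩ := hB.exists_notMem_finite hI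
  obtain ⟨v, hv⟩ := exists_ne (y b)
  refine ⟨Function.update y b v, ⟨htU fun i hi => ?_, fun j hj => ?_⟩, fun h => ?_⟩
  · rw [Function.update_of_ne (by rintro rfl; exact hbI hi)]
    exact mem_of_mem_nhds (ht i)
  · rw [Function.update_of_ne (by rintro rfl; exact hj hbB)]
    exact hy j hj
  · exact hv (by simpa using congrFun h b)

/-- A continuous injective image of a compact perfect set is perfect. -/
theorem IsPerfectSet.image {X Y : Type*} [TopologicalSpace X] [TopologicalSpace Y] [CompactSpace X]
    [T2Space Y] {C : Set X} (hC : IsPerfectSet C) {f : X → Y} (hf : Continuous f)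
    (hinj : Function.Injective f) : IsPerfectSet (f '' C) := by
  refine ⟨⟨(hC.1.closed.isCompact.image hf).isClosed, preperfect_iff_nhds.2 ?_⟩, hC.2.image f⟩
  rintro _ ⟨x, hx, rfl⟩ U hU
  obtain ⟨y, ⟨hyU, hyC⟩, hne⟩ := preperfect_iff_nhds.1 hC.1.acc x hx _ (hf.continuousAt hU)
  exact ⟨f y, ⟨hyU, mem_image_of_mem f hyC⟩, hinj.ne hne⟩

/-- A perfect subset of the Cantor space contains a homeomorphic copy of the Cantor space. -/
theorem IsPerfectSet.exists_injection {C : Set Cantor} (hC : IsPerfectSet C) :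
    ∃ h : Cantor → Cantor, (∀ c, h c ∈ C) ∧ Continuous h ∧ Function.Injective h := by
  let := TopologicalSpace.upgradeIsCompletelyMetrizable Cantor
  obtain ⟨h, hr, hc, hi⟩ := hC.1.exists_nat_bool_injection hC.2
  exact ⟨h, fun c => hr (mem_range_self c), hc, hi⟩

section Bits

variable {J : Type*} [DecidableEq J]

theorem tendsto_single_one {b : ℕ → J} (hb : Function.Injective b) :
    Tendsto (fun n => (Pi.single (b n) 1 : J → ZMod 2)) atTop (𝓝 0) := by
  rw [tendsto_pi_nhds]
  intro i
  have h : ∀ᶠ n in atTop, b n ≠ i := by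
    have := (hb.tendsto_cofinite).eventually (eventually_cofinite_ne i)
    rwa [Nat.cofinite_eq_atTop] at this
  refine tendsto_const_nhds.congr' ?_
  filter_upwards [h] with n hn
  simp [Pi.single_eq_of_ne hn.symm]

/-- A closed set of positive Haar measure still has positive measure after being intersected with
its shift by all sufficiently late bits. -/
theorem eventually_measure_inter_shift_ne_zero [Countable J] (μ : Measure (J → ZMod 2))
    [μ.IsAddHaarMeasure] {K : Set (J → ZMod 2)} (hK : IsClosed K) (hμ : μ K ≠ 0)
    {b : ℕ → J} (hb : Function.Injective b) :
    ∀ᶠ n in atTop, μ {x ∈ K | x + Pi.single (b n) 1 ∈ K} ≠ 0 := by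
  -- Late bits tend to 0, so `(e +ᵥ K) \ K` has small measure; were the intersection null, it would
  -- have measure at least `μ K`.
  have h0 := (tendsto_measure_vadd_sdiff_isCompact_isClosed (μ := μ) hK.isCompact hK).comp
    (tendsto_single_one hb)
  filter_upwards [h0.eventually_lt_const (pos_iff_ne_zero.2 hμ)] with n hn hz
  set e : J → ZMod 2 := Pi.single (b n) 1
  have hsub : e +ᵥ K ⊆ (e +ᵥ K) \ K ∪ {x ∈ K | x + e ∈ K} := by
    rintro _ ⟨x, hx, rfl⟩
    by_cases h : e + x ∈ K
    · refine Or.inr ⟨h, ?_⟩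
      have : (fun x => e +ᵥ x) x + e = x := by
        funext j
        simp only [vadd_eq_add, Pi.add_apply]
        rw [add_comm, ← add_assoc, CharTwo.add_self_eq_zero, zero_add]
      rwa [this]
    · exact Or.inl ⟨⟨x, hx, rfl⟩, h⟩
  have := (measure_mono (μ := μ) hsub).trans (measure_union_le _ _)
  rw [hz, add_zero, measure_vadd] at this
  exact absurd hn (not_lt.2 this)

/-- From a point of `K n`, the first `n` bits of `b` can be changed freely without leaving `K 0`.
Compactness gives a point of every `K n`, and closedness of `K 0` passes from finitely many changes
to infinitely many. -/
theorem exists_agreeOff_subset_of_shift {K : ℕ → Set (J → ZMod 2)} (hK : ∀ n, IsClosed (K n))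
    (b : ℕ → J) (hstep : ∀ n, K (n + 1) = {x ∈ K n | x + Pi.single (b n) 1 ∈ K n})
    (hne : ∀ n, (K n).Nonempty) : ∃ x, agreeOff (range b) x ⊆ K 0 := by
  obtain ⟨x, hx⟩ := IsCompact.nonempty_iInter_of_sequence_nonempty_isCompact_isClosed K
    (fun n => by rw [hstep]; exact sep_subset _ _) hne (hK 0).isCompact hK
  have key : ∀ n, ∀ x ∈ K n, agreeOff (b '' Iio n) x ⊆ K 0 := by
    intro n
    induction n with
    | zero =>
      intro x hx y hy
      rwa [show y = x from funext fun j => hy j (by simp)]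
    | succ n ih =>
      intro x hx y hy
      rw [hstep] at hx
      have hn : ∀ j, j ∉ b '' Iio n → j ≠ b n → j ∉ b '' Iio (n + 1) := by
        rintro j h1 h2 ⟨i, hi, rfl⟩
        rcases Nat.lt_succ_iff_lt_or_eq.1 hi with h | rfl
        exacts [h1 ⟨i, h, rfl⟩, h2 rfl]
      by_cases h : y (b n) = x (b n)
      · refine ih x hx.1 fun j hj => ?_
        by_cases hjn : j = b n
        · rw [hjn, h]
        · exact hy j (hn j hj hjn)
      · refine ih _ hx.2 fun j hj => ?_
        by_cases hjn : j = b n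
        · have : ∀ u v : ZMod 2, u ≠ v → u = v + 1 := by decide
          simpa [hjn] using this _ _ h
        · simpa [hjn] using hy j (hn j hj hjn)
  refine ⟨x, fun y hy => ?_⟩
  classical
  let z : ℕ → J → ZMod 2 := fun n j => if j ∈ b '' Iio n then y j else x j
  have hz : Tendsto z atTop (𝓝 y) := by
    rw [tendsto_pi_nhds]
    intro j
    refine tendsto_const_nhds.congr' ?_
    by_cases hj : j ∈ range b
    · obtain ⟨i, rfl⟩ := hj
      filter_upwards [eventually_gt_atTop i] with n hn
      exact (if_pos ⟨i, hn, rfl⟩).symm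
    · refine Eventually.of_forall fun n => ?_
      by_cases h : j ∈ b '' Iio n
      · exact (if_pos h).symm
      · exact (hy j hj).trans (if_neg h).symm
  exact (hK 0).mem_of_tendsto hz (Eventually.of_forall fun n =>
    key n x (mem_iInter.1 hx n) fun j hj => if_neg hj)

end Bits

/-- A closed set of positive measure in `2^(ω × ω)` contains a product of perfect sets, each of
them obtained by freeing infinitely many bits in its row. -/
theorem exists_agreeOff_subset_of_measure_ne_zero (μ : Measure (ℕ × ℕ → ZMod 2))
    [μ.IsAddHaarMeasure] {K : Set (ℕ × ℕ → ZMod 2)} (hK : IsClosed K) (hμ : μ K ≠ 0) :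
    ∃ (B : Set (ℕ × ℕ)) (x : ℕ × ℕ → ZMod 2), (∀ n, {j | (n, j) ∈ B}.Infinite) ∧
      agreeOff B x ⊆ K := by
  let S := {L : Set (ℕ × ℕ → ZMod 2) // IsClosed L ∧ μ L ≠ 0}
  -- Stage `m` frees a bit in row `(Nat.unpair m).1`, so every row recurs; `m < j` makes its freed
  -- columns unbounded.
  have hex : ∀ (m : ℕ) (L : S), ∃ j, m < j ∧
      μ {x ∈ L.1 | x + Pi.single ((Nat.unpair m).1, j) 1 ∈ L.1} ≠ 0 := fun m L =>
    ((eventually_gt_atTop m).and (eventually_measure_inter_shift_ne_zero μ L.2.1 L.2.2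
      (b := fun j => ((Nat.unpair m).1, j)) fun _ _ h => (Prod.ext_iff.1 h).2)).exists
  choose c hcm hc using hex
  let next : ℕ → S → S := fun m L =>
    ⟨_, L.2.1.inter (L.2.1.preimage (continuous_add_const _)), hc m L⟩
  let L : ℕ → S := fun n => Nat.rec ⟨K, hK, hμ⟩ next n
  let b : ℕ → ℕ × ℕ := fun m => ((Nat.unpair m).1, c m (L m))
  obtain ⟨x, hx⟩ := exists_agreeOff_subset_of_shift (K := fun n => (L n).1) (fun n => (L n).2.1) b
    (fun n => rfl) fun n => nonempty_of_measure_ne_zero (L n).2.2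
  refine ⟨range b, x, fun n => ?_, hx⟩
  refine infinite_of_forall_exists_gt fun a => ⟨c (Nat.pair n a) (L (Nat.pair n a)),
    ⟨Nat.pair n a, by simp [b]⟩, (Nat.right_le_pair n a).trans_lt (hcm _ _)⟩

/-- A null-measurable set of positive measure contains a closed set of positive measure. -/
theorem exists_isClosed_subset_of_measure_ne_zero {X : Type*} [TopologicalSpace X]
    [MeasurableSpace X] [BorelSpace X] (μ : Measure X) [IsFiniteMeasure μ] [μ.WeaklyRegular]
    {A : Set X} (hA : NullMeasurableSet A μ) (hμ : μ A ≠ 0) :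
    ∃ K ⊆ A, IsClosed K ∧ μ K ≠ 0 := by
  obtain ⟨A', hA', hm, hae⟩ := hA.exists_measurable_subset_ae_eq
  rw [← measure_congr hae] at hμ
  obtain ⟨K, hK, hc, hlt⟩ :=
    hm.exists_lt_isClosed_of_ne_top (measure_ne_top μ A') (pos_iff_ne_zero.2 hμ)
  exact ⟨K, hK.trans hA', hc, hlt.ne'⟩

/-- The canonical identification of the two-point spaces. -/
def bitHomeomorph : ZMod 2 ≃ₜ Bool where
  toEquiv := finTwoEquiv
  continuous_toFun := continuous_of_discreteTopology
  continuous_invFun := continuous_of_discreteTopology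

/-- Every cube has a subcube whose range is perfect and is contained in, or disjoint from, a given
universally measurable set. -/
theorem IsUniversallyMeasurable.exists_subcube {P : Type u} [TopologicalSpace P] [T2Space P]
    {A : Set P} (hA : IsUniversallyMeasurable A) (f : Cube P) :
    ∃ g : Cube P, g.graph ⊆ f.graph ∧ IsPerfectSet g.range ∧ (g.range ⊆ A ∨ g.range ⊆ Aᶜ) := by
  borelize P
  choose h hmem hcont hinj using fun n => (f.isPerfectSet_side n).exists_injection
  let row (n : ℕ) (w : ℕ × ℕ → ZMod 2) : Cantor := fun j => bitHomeomorph (w (n, j))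
  have hrow (n : ℕ) : Continuous (row n) :=
    continuous_pi fun j => bitHomeomorph.continuous.comp (continuous_apply _)
  let F (w : ℕ × ℕ → ZMod 2) : P := f.toFun fun n => ⟨h n (row n w), hmem n _⟩
  have hF : Continuous F := f.continuous_toFun.comp <|
    continuous_pi fun n => ((hcont n).comp (hrow n)).subtype_mk _
  have hFinj : Function.Injective F := by
    intro v w hvw
    funext ⟨n, j⟩
    have := congrFun (hinj n (Subtype.ext_iff.1 (congrFun (f.injective_toFun hvw) n))) j
    exact bitHomeomorph.injective this
  let μ : Measure (ℕ × ℕ → ZMod 2) := Measure.addHaar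
  have hpre {A : Set P} (hA : NullMeasurableSet A (μ.map F)) : NullMeasurableSet (F ⁻¹' A) μ :=
    hA.preimage ⟨hF.measurable, Measure.AbsolutelyContinuous.rfl⟩
  have hA0 : NullMeasurableSet A (μ.map F) := hA _ inferInstance
  obtain ⟨A', hA', hA'n, hne⟩ : ∃ A', (A' = A ∨ A' = Aᶜ) ∧ NullMeasurableSet (F ⁻¹' A') μ ∧
      μ (F ⁻¹' A') ≠ 0 := by
    by_cases h0 : μ (F ⁻¹' A) = 0
    · refine ⟨Aᶜ, Or.inr rfl, hpre hA0.compl, fun h1 => ?_⟩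
      have := measure_union_null h0 h1
      rw [← preimage_union, union_compl_self, preimage_univ] at this
      exact NeZero.ne μ (Measure.measure_univ_eq_zero.1 this)
    · exact ⟨A, Or.inl rfl, hpre hA0, h0⟩
  obtain ⟨K, hKA, hK, hKμ⟩ := exists_isClosed_subset_of_measure_ne_zero μ hA'n hne
  obtain ⟨B, x, hB, hBK⟩ := exists_agreeOff_subset_of_measure_ne_zero μ hK hKμ
  let D (n : ℕ) : Set Cantor := h n '' agreeOff {j | (n, j) ∈ B} (row n x)
  have hDside (n : ℕ) : D n ⊆ f.side n := by
    rintro _ ⟨c, -, rfl⟩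
    exact hmem n c
  let g : Cube P :=
    { side := D
      isPerfectSet_side := fun n => (isPerfectSet_agreeOff (hB n) _).image (hcont n) (hinj n)
      toFun := fun y => f.toFun fun n => ⟨y n, hDside n (y n).2⟩
      continuous_toFun := f.continuous_toFun.comp <| continuous_pi fun n =>
        (continuous_subtype_val.comp (continuous_apply n)).subtype_mk _
      injective_toFun := fun y z hyz => funext fun n =>
        Subtype.ext (congrArg Subtype.val (congrFun (f.injective_toFun hyz) n) :) }
  -- Freeing the bits in `B` acts independently on each row, so `agreeOff B x` is a product over
  -- rows.
  have hrange : g.range = F '' agreeOff B x := by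
    ext p
    constructor
    · rintro ⟨y, rfl⟩
      choose c hc hcy using fun n => (y n).2
      refine ⟨fun q => bitHomeomorph.symm (c q.1 q.2), fun q hq => ?_, ?_⟩
      · have := hc q.1 q.2 hq
        simp [this, row]
      · refine congrArg f.toFun (funext fun n => Subtype.ext ?_)
        simp only [row, Homeomorph.apply_symm_apply]
        exact hcy n
    · rintro ⟨w, hw, rfl⟩
      exact ⟨fun n => ⟨h n (row n w), _, fun j hj => congrArg bitHomeomorph (hw _ hj), rfl⟩, rfl⟩
  have hBinf : B.Infinite := fun hfin =>
    hB 0 (hfin.preimage (f := fun j => (0, j)) fun _ _ _ _ h => (Prod.ext_iff.1 h).2)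
  have hsub : g.range ⊆ A' := by
    rw [hrange]
    exact image_subset_iff.2 (hBK.trans hKA)
  refine ⟨g, ?_, hrange ▸ (isPerfectSet_agreeOff hBinf x).image hF hFinj, ?_⟩
  · rintro p ⟨y, hy, hp⟩
    exact ⟨fun n => ⟨y n, hDside n (y n).2⟩, hy, hp⟩
  · rcases hA' with rfl | rfl
    exacts [Or.inl hsub, Or.inr hsub]

end CPACube

theorem mainTheorem6 (P : Type u) [TopologicalSpace P] [PolishSpace P]
    (hP : CPACube.CPACubeAxiom P) (A : Set P) (hA : CPACube.IsUniversallyMeasurable A) :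
    ∃ S : Set (Set P), Cardinal.mk S ≤ Cardinal.aleph 1 ∧
      (∀ C ∈ S, CPACube.IsPerfectSet C ∨ ∃ x : P, C = {x}) ∧ ⋃₀ S = A := by
  obtain ⟨E₀, hE, hcard, hcompl⟩ := hP {C | CPACube.IsPerfectSet C ∧ (C ⊆ A ∨ C ⊆ Aᶜ)}
    (fun C hC => hC.1) fun f => hA.exists_subcube f
  refine ⟨{C ∈ E₀ | C ⊆ A} ∪ singleton '' (A \ ⋃₀ E₀), ?_, ?_, ?_⟩
  · refine (Cardinal.mk_union_le _ _).trans <| Cardinal.add_le_of_le (Cardinal.aleph0_le_aleph 1)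
      ((Cardinal.mk_le_mk_of_subset (sep_subset _ _)).trans hcard) ?_
    exact Cardinal.mk_image_le.trans
      ((Cardinal.mk_le_mk_of_subset fun x hx => hx.2).trans hcompl)
  · rintro C (hC | ⟨x, -, rfl⟩)
    exacts [Or.inl (hE hC.1).1, Or.inr ⟨x, rfl⟩]
  · apply Subset.antisymm
    · rintro x ⟨C, hC | ⟨y, hy, rfl⟩, hx⟩
      · exact hC.2 hx
      · rw [mem_singleton_iff.1 hx]
        exact hy.1
    · intro x hx
      by_cases h : x ∈ ⋃₀ E₀
      · obtain ⟨C, hC, hxC⟩ := h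
        exact ⟨C, Or.inl ⟨hC, (hE hC).2.resolve_right fun h' => h' hxC hx⟩, hxC⟩
      · exact ⟨{x}, Or.inr ⟨x, ⟨hx, h⟩, rfl⟩, rfl⟩
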